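/- Let $\mathcal H\subset\mathbb R^2$ be an open set (not necessarily connected) with $B_2(0)\subset\mathcal H\subset B_{\mathcal R}(0)$ for some $\mathcal R\in(2,\infty)$. Let $J\in C^2_c(\mathbb R^2)$ be radially symmetric, with $J(x)>0$ if $|x|<d$, $J(x)=0$ if $|x|\ge d$, and $\int_{\mathbb R^2}J=1$, and write $Lg:=J*g-g$. Let $u_0\ge 0$ satisfy $u_0=0$ in $\mathcal H$ and $u_0\in L^\infty(\mathbb R^2)\cap L^1(\mathbb R^2,\log|x|\,dx)$. Let $u\in C([0,\infty);L^1(\mathbb R^2))$ be the solution of $$\partial_t u=Lu\ \text{ in }(\mathbb R^2\setminus\mathcal H)\times(0,\infty),\qquad u=0\ \text{ in }\mathcal H\times(0,\infty),\qquad u(\cdot,0)=u_0\ \text{ in }\mathbb R^2,$$ where $\partial_t u$ is the derivative of the curve $t\mapsto u(\cdot,t)$ in $L^1(\mathbb R^2)$, and let $\phi$ be the solution of the stationary problem $$L\phi=0\ \text{ in }\mathbb R^2\setminus\mathcal H,\qquad \phi=0\ \text{ in }\mathcal H,\qquad \phi-\log|\cdot|\in L^\infty(\mathbb R^2\setminus\mathcal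 H).$$ (Identities between functions of $x$ are understood almost everywhere.) Then $u(\cdot,t)\log|\cdot|\in L^1(\mathbb R^2)$ for every $t\ge0$, $u_0\phi\in L^1(\mathbb R^2)$, and $$\lim_{t\to\infty}\int_{\mathbb R^2}u(x,t)\log|x|\,dx=M^*_\phi:=\int_{\mathbb R^2}u_0(x)\phi(x)\,dx.$$ -/

import Mathlib

open MeasureTheory Filter Topology

noncomputable section

/-- The Euclidean plane `ℝ²`. -/
abbrev Plane : Type := EuclideanSpace ℝ (Fin 2)

/-- The space `L¹(ℝ²)` of (classes of) real integrable functions. -/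
abbrev L1Plane : Type := Lp ℝ 1 (volume : Measure Plane)

/-- The hole: an open set with `B₂(0) ⊆ H ⊆ B_R(0)` for some finite `R > 2`. -/
structure IsHole (H : Set Plane) : Prop where
  isOpen : IsOpen H
  ball_subset : Metric.ball 0 2 ⊆ H
  subset_ball : ∃ R : ℝ, 2 < R ∧ H ⊆ Metric.ball 0 R

/-- The kernel: of class `C²`, radially symmetric, positive on `B_d(0)`, zero outside, with
integral one. -/
structure IsKernel (J : Plane → ℝ) (d : ℝ) : Prop where
  contDiff : ContDiff ℝ 2 J
  radial : ∀ x y : Plane, ‖x‖ = ‖y‖ → J x = J y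
  pos : ∀ x : Plane, ‖x‖ < d → 0 < J x
  zero : ∀ x : Plane, d ≤ ‖x‖ → J x = 0
  integral_eq_one : ∫ x, J x = 1

/-- The nonlocal operator `L g = J * g - g`. -/
def nonlocalOp (J g : Plane → ℝ) (x : Plane) : ℝ :=
  convolution J g (ContinuousLinearMap.lsmul ℝ ℝ) volume x - g x

/-- Initial data: `u₀ ≥ 0`, `u₀ = 0` in `H`, `u₀ ∈ L^∞(ℝ²) ∩ L¹(ℝ², log|x| dx)`.
(Such `u₀` are integrable, because `log|x| ≥ log 2` where `u₀` does not vanish.) -/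
structure IsInitialDatum (H : Set Plane) (u₀ : Plane → ℝ) : Prop where
  nonneg : ∀ᵐ x : Plane, 0 ≤ u₀ x
  zero_on_hole : ∀ᵐ x : Plane, x ∈ H → u₀ x = 0
  bounded : MemLp u₀ ⊤ volume
  log_integrable : Integrable (fun x : Plane => u₀ x * Real.log ‖x‖) volume

/-- `u ∈ C([0,∞); L¹(ℝ²))` solves `∂ₜu = Lu` in `(ℝ² \ H) × (0,∞)`, `u = 0` in `H × (0,∞)`,
`u(·,0) = u₀`. The time derivative is that of the curve `t ↦ u(·,t)` in `L¹(ℝ²)`; since this curve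
vanishes on `H`, so does its derivative, which therefore is `Lu(·,t)` off `H` and zero on `H`. -/
structure IsSolution (J : Plane → ℝ) (H : Set Plane) (u₀ : Plane → ℝ) (u : ℝ → L1Plane) :
    Prop where
  continuousOn : ContinuousOn u (Set.Ici 0)
  initial : u 0 =ᵐ[volume] u₀
  zero_on_hole : ∀ t : ℝ, 0 < t → ∀ᵐ x : Plane, x ∈ H → u t x = 0
  equation : ∀ t : ℝ, 0 < t → ∃ v : L1Plane, HasDerivAt u v t ∧
    ∀ᵐ x : Plane, x ∉ H → v x = nonlocalOp J (u t) x

/-- `φ` solves `Lφ = 0` in `ℝ² \ H`, `φ = 0` in `H`, and `φ - log|x| ∈ L^∞(ℝ² \ H)`.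
The identities are required almost everywhere, so every pointwise solution is one. -/
structure IsLogStationary (J : Plane → ℝ) (H : Set Plane) (φ : Plane → ℝ) : Prop where
  equation : ∀ᵐ x : Plane, x ∉ H → nonlocalOp J φ x = 0
  zero_on_hole : ∀ᵐ x : Plane, x ∈ H → φ x = 0
  log_behavior : MemLp (fun x : Plane => φ x - Real.log ‖x‖) ⊤ (volume.restrict Hᶜ)

end

/-! Let P be averaging with J followed by killing in H, an operator of norm at most one on L¹. The
problem reads u' = (P - 1)u, so u(t) = Σ e^{-t} tⁿ/n! · Pⁿu₀ (`IsSolution.eq_exp`): the density at a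
Poisson number of steps of a random walk that dies on landing in H. Poisson averages of a convergent
sequence have the same limit (`tendsto_tsum_poisson_mul`), so it suffices to study aₙ = Pⁿu₀.

Averaging is symmetric because J is even, and with Lφ = 0 off H this gives ∫ aₙφ = ∫ u₀φ for all n
(`integral_killedAvg_pow_mul`). Since φ - log|x| is bounded off H, the logarithmic moment of aₙ
differs from this constant by at most a multiple of the mass ∫ aₙ. It remains to see that the mass
tends to zero (`tendsto_integral_killedAvg_pow`).

Mass cannot escape to infinity: the logarithmic moments are bounded in n, so the mass outside B_R is
O(1/log R) uniformly. Nor can it stay in a ball: the total mass ever absorbed is at most ∫ u₀, and a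
fixed fraction of the mass in B_{r+d/2} jumps into H or into B_r at the next step. Starting from B₂
⊆ H, where there is no mass, induction on the radius shows that the mass of aₙ in any ball is
summable in n (`summable_setIntegral_ball`). -/

/-! ### Averaging with the kernel and the killed operator on L¹. -/

/-- The average `∫ J(x - y) g(y) dy`, that is, the convolution `J * g`. -/
noncomputable def kernelAvg (J g : Plane → ℝ) (x : Plane) : ℝ := ∫ y, J (x - y) * g y

theorem nonlocalOp_eq (J g : Plane → ℝ) (x : Plane) :
    nonlocalOp J g x = kernelAvg J g x - g x := by
  simp [nonlocalOp, kernelAvg, convolution_lsmul_swap]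

namespace IsKernel

variable {J : Plane → ℝ} {d : ℝ}

theorem nonneg (hJ : IsKernel J d) (x : Plane) : 0 ≤ J x := by
  rcases lt_or_ge ‖x‖ d with h | h
  · exact (hJ.pos x h).le
  · exact (hJ.zero x h).ge

theorem even (hJ : IsKernel J d) (x y : Plane) : J (x - y) = J (y - x) :=
  hJ.radial _ _ (norm_sub_rev x y)

theorem range_pos (hJ : IsKernel J d) : 0 < d := by
  by_contra! h
  have h0 : J = 0 := funext fun x => hJ.zero x (h.trans (norm_nonneg x))
  simpa [h0] using hJ.integral_eq_one

theorem integrable (hJ : IsKernel J d) : Integrable J := by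
  by_contra h
  simpa [integral_undef h] using hJ.integral_eq_one

theorem hasCompactSupport (hJ : IsKernel J d) : HasCompactSupport J :=
  HasCompactSupport.intro (isCompact_closedBall (0 : Plane) d) fun x hx =>
    hJ.zero x (by simpa using (not_le.1 (fun h => hx (by simpa using h))).le)

theorem dist_lt (hJ : IsKernel J d) {x y : Plane} (h : J (x - y) ≠ 0) : ‖x - y‖ < d := by
  by_contra! hd
  exact h (hJ.zero _ hd)

theorem integral_sub_right (hJ : IsKernel J d) (x : Plane) : ∫ y, J (y - x) = 1 := by
  rw [integral_sub_right_eq_self (fun y => J y) x, hJ.integral_eq_one]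

theorem kernelAvg_const (hJ : IsKernel J d) (c : ℝ) (x : Plane) :
    kernelAvg J (fun _ => c) x = c := by
  simp only [kernelAvg, hJ.even x]
  rw [integral_mul_const, hJ.integral_sub_right, one_mul]

theorem kernelAvg_nonneg (hJ : IsKernel J d) {f : Plane → ℝ} (hf : ∀ᵐ x, 0 ≤ f x) (x : Plane) :
    0 ≤ kernelAvg J f x :=
  integral_nonneg_of_ae (hf.mono fun _ hy => mul_nonneg (hJ.nonneg _) hy)

/-- Absolute convergence of the double integral of `J(x - y) f(y) g(x)` when `f` is integrable
against a weight that dominates `g` and varies by at most a factor over the range of `J`. -/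
theorem integrable_prod (hJ : IsKernel J d) {f g w : Plane → ℝ} {K C : ℝ}
    (hw : ∀ x y : Plane, ‖x - y‖ < d → w x ≤ K * w y)
    (hf : AEStronglyMeasurable f volume) (hfw : Integrable (fun y => f y * w y))
    (hg : AEStronglyMeasurable g volume) (hC : 0 ≤ C) (hgw : ∀ᵐ x, |g x| ≤ C * w x) :
    Integrable (fun p : Plane × Plane => J (p.1 - p.2) * f p.2 * g p.1)
      (volume.prod volume) := by
  -- The majorant is the convolution integrand of the integrable functions fw and J: where J(x - y)
  -- ≠ 0, one has |g(x)| ≤ C w(x) ≤ C K w(y).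
  have h1 : Integrable (fun p : Plane × Plane => f p.2 * w p.2 * J (p.1 - p.2))
      (volume.prod volume) := by
    simpa using hfw.convolution_integrand (ContinuousLinearMap.mul ℝ ℝ) hJ.integrable
  have hJm : AEStronglyMeasurable (fun p : Plane × Plane => J (p.1 - p.2))
      (volume.prod volume) :=
    (hJ.contDiff.continuous.comp (continuous_fst.sub continuous_snd)).aestronglyMeasurable
  refine (h1.const_mul (C * K)).mono ((hJm.mul hf.comp_snd).mul hg.comp_fst) ?_
  have h2 : ∀ᵐ p : Plane × Plane ∂(volume.prod volume), |g p.1| ≤ C * w p.1 :=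
    Measure.quasiMeasurePreserving_fst.ae hgw
  filter_upwards [h2] with p hp
  by_cases h0 : J (p.1 - p.2) = 0
  · simp [h0]
  have h3 := hw p.1 p.2 (hJ.dist_lt h0)
  have h4 : |g p.1| ≤ C * (K * w p.2) := hp.trans (mul_le_mul_of_nonneg_left h3 hC)
  calc ‖J (p.1 - p.2) * f p.2 * g p.1‖ = |J (p.1 - p.2)| * |f p.2| * |g p.1| := by
        simp
    _ ≤ |J (p.1 - p.2)| * |f p.2| * |C * (K * w p.2)| :=
        mul_le_mul_of_nonneg_left (h4.trans (le_abs_self _)) (by positivity)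
    _ = ‖C * K * (f p.2 * w p.2 * J (p.1 - p.2))‖ := by
        simp only [Real.norm_eq_abs, abs_mul]; ring

theorem integrable_kernelAvg_mul (hJ : IsKernel J d) {f g w : Plane → ℝ} {K C : ℝ}
    (hw : ∀ x y : Plane, ‖x - y‖ < d → w x ≤ K * w y)
    (hf : AEStronglyMeasurable f volume) (hfw : Integrable (fun y => f y * w y))
    (hg : AEStronglyMeasurable g volume) (hC : 0 ≤ C) (hgw : ∀ᵐ x, |g x| ≤ C * w x) :
    Integrable (fun x => kernelAvg J f x * g x) := by
  refine (hJ.integrable_prod hw hf hfw hg hC hgw).integral_prod_left.congr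
    (Eventually.of_forall fun x => ?_)
  simp only [kernelAvg, ← integral_mul_const]

/-- The operator `g ↦ J * g` is symmetric. -/
theorem integral_kernelAvg_mul (hJ : IsKernel J d) {f g w : Plane → ℝ} {K C : ℝ}
    (hw : ∀ x y : Plane, ‖x - y‖ < d → w x ≤ K * w y)
    (hf : AEStronglyMeasurable f volume) (hfw : Integrable (fun y => f y * w y))
    (hg : AEStronglyMeasurable g volume) (hC : 0 ≤ C) (hgw : ∀ᵐ x, |g x| ≤ C * w x) :
    ∫ x, kernelAvg J f x * g x = ∫ x, f x * kernelAvg J g x := by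
  have := integral_integral_swap (f := fun x y => J (x - y) * f y * g x)
    (hJ.integrable_prod hw hf hfw hg hC hgw)
  simp only [kernelAvg, ← integral_mul_const, ← integral_const_mul]
  rw [this]
  congr 1; ext y; congr 1; ext x
  rw [hJ.even x y]; ring

theorem integrable_kernelAvg (hJ : IsKernel J d) {f : Plane → ℝ} (hf : Integrable f) :
    Integrable (kernelAvg J f) := by
  simpa using hJ.integrable_kernelAvg_mul (w := fun _ => 1) (g := fun _ => 1) (K := 1) (C := 1)
    (by simp) hf.1 (by simpa using hf) aestronglyMeasurable_const zero_le_one (by simp)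

theorem integral_kernelAvg_mul_of_bounded (hJ : IsKernel J d) {f g : Plane → ℝ}
    (hf : Integrable f) (hg : AEStronglyMeasurable g volume) {C : ℝ} (hC : 0 ≤ C)
    (hgC : ∀ᵐ x, |g x| ≤ C) : ∫ x, kernelAvg J f x * g x = ∫ x, f x * kernelAvg J g x :=
  hJ.integral_kernelAvg_mul (w := fun _ => 1) (K := 1) (by simp) hf.1 (by simpa using hf) hg hC
    (by simpa using hgC)

/-- Symmetry tested against the constant 1, which averaging fixes. -/
theorem integral_kernelAvg (hJ : IsKernel J d) {f : Plane → ℝ} (hf : Integrable f) :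
    ∫ x, kernelAvg J f x = ∫ x, f x := by
  have := hJ.integral_kernelAvg_mul_of_bounded (g := fun _ => 1) hf aestronglyMeasurable_const
    zero_le_one (by simp)
  simpa [hJ.kernelAvg_const] using this

theorem abs_kernelAvg_le (hJ : IsKernel J d) (f : Plane → ℝ) (x : Plane) :
    |kernelAvg J f x| ≤ kernelAvg J (fun y => |f y|) x := by
  refine (abs_integral_le_integral_abs (f := fun y => J (x - y) * f y)).trans_eq ?_
  simp [kernelAvg, abs_mul, abs_of_nonneg (hJ.nonneg _)]

theorem kernelAvg_congr {f g : Plane → ℝ} (h : f =ᵐ[volume] g) :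
    kernelAvg J f = kernelAvg J g := by
  ext x
  exact integral_congr_ae (h.mono fun y hy => by simp only [hy])

theorem integrable_mul_of_integrable (hJ : IsKernel J d) {f : Plane → ℝ} (hf : Integrable f)
    (x : Plane) : Integrable (fun y => J (x - y) * f y) := by
  obtain ⟨C, hC⟩ := hJ.hasCompactSupport.exists_bound_of_continuous hJ.contDiff.continuous
  exact hf.bdd_mul ((hJ.contDiff.continuous.comp
    (continuous_const.sub continuous_id)).aestronglyMeasurable) (Eventually.of_forall fun y => hC _)

theorem kernelAvg_add (hJ : IsKernel J d) {f g : Plane → ℝ} (hf : Integrable f)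
    (hg : Integrable g) (x : Plane) :
    kernelAvg J (fun y => f y + g y) x = kernelAvg J f x + kernelAvg J g x := by
  simp only [kernelAvg, mul_add]
  exact integral_add (hJ.integrable_mul_of_integrable hf x) (hJ.integrable_mul_of_integrable hg x)

theorem kernelAvg_const_mul (c : ℝ) (f : Plane → ℝ) (x : Plane) :
    kernelAvg J (fun y => c * f y) x = c * kernelAvg J f x := by
  simp only [kernelAvg, ← integral_const_mul]
  congr 1; ext y; ring

/-- The operator `f ↦ J * f` on `L¹`, followed by killing in `H`. -/
noncomputable def killedAvg (hJ : IsKernel J d) {H : Set Plane} (hH : MeasurableSet H) :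
    L1Plane →L[ℝ] L1Plane :=
  LinearMap.mkContinuous
    { toFun := fun f => ((hJ.integrable_kernelAvg (L1.integrable_coeFn f)).indicator
        hH.compl).toL1 _
      map_add' := fun f g => by
        rw [← Integrable.toL1_add, Integrable.toL1_eq_toL1_iff]
        refine Eventually.of_forall fun x => ?_
        rw [kernelAvg_congr (Lp.coeFn_add f g)]
        by_cases hx : x ∈ Hᶜ
        · simpa [hx, Pi.add_def] using hJ.kernelAvg_add (L1.integrable_coeFn f) (L1.integrable_coeFn g) x
        · simp [hx]
      map_smul' := fun c f => by
        simp only [RingHom.id_apply]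
        rw [← Integrable.toL1_smul, Integrable.toL1_eq_toL1_iff]
        refine Eventually.of_forall fun x => ?_
        rw [kernelAvg_congr (Lp.coeFn_smul c f)]
        by_cases hx : x ∈ Hᶜ
        · simpa [hx, Pi.smul_def] using kernelAvg_const_mul c f x
        · simp [hx] }
    -- Norm bound 1: |J * f| ≤ J * |f|, the latter has the mass of |f|, and killing only removes
    -- mass.
    1 (fun f => by
      simp only [LinearMap.coe_mk, AddHom.coe_mk, one_mul]
      have hf := L1.integrable_coeFn f
      rw [L1.norm_eq_integral_norm, L1.norm_eq_integral_norm]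
      simp only [Real.norm_eq_abs]
      rw [← hJ.integral_kernelAvg hf.abs]
      refine integral_mono_ae (L1.integrable_coeFn _).abs (hJ.integrable_kernelAvg hf.abs) ?_
      filter_upwards [Integrable.coeFn_toL1 ((hJ.integrable_kernelAvg hf).indicator hH.compl)]
        with x hx
      simp only [hx]
      by_cases h : x ∈ Hᶜ
      · simpa only [Set.indicator_of_mem h] using hJ.abs_kernelAvg_le f x
      · simpa only [Set.indicator_of_notMem h, abs_zero] using
          hJ.kernelAvg_nonneg (Eventually.of_forall fun x => abs_nonneg _) x)

theorem killedAvg_coeFn (hJ : IsKernel J d) {H : Set Plane} (hH : MeasurableSet H)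
    (f : L1Plane) : hJ.killedAvg hH f =ᵐ[volume] Hᶜ.indicator (kernelAvg J f) :=
  Integrable.coeFn_toL1 ((hJ.integrable_kernelAvg (L1.integrable_coeFn f)).indicator hH.compl)

end IsKernel

/-! ### The solution as a Poisson average of powers of the killed operator. -/

/-- A bounded linear evolution equation in a Banach space has only the exponential solution. -/
theorem eq_exp_apply_of_hasDerivAt {E : Type*} [NormedAddCommGroup E] [NormedSpace ℝ E]
    [CompleteSpace E] (A : E →L[ℝ] E) {u : ℝ → E} (hc : ContinuousOn u (Set.Ici 0))
    (hu : ∀ t : ℝ, 0 < t → HasDerivAt u (A (u t)) t) {t : ℝ} (ht : 0 ≤ t) :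
    u t = NormedSpace.exp (t • A) (u 0) := by
  -- With S(s) = exp(-sA), the product S(s)u(s) has zero derivative, hence is constant.
  set S : ℝ → E →L[ℝ] E := fun s => NormedSpace.exp (s • (-A)) with hS
  have hSd : ∀ s, HasDerivAt S (S s * (-A)) s := fun s => hasDerivAt_exp_smul_const (-A) s
  have hSc : Continuous S := continuous_iff_continuousAt.2 fun s => (hSd s).continuousAt
  have hd : ∀ s, 0 < s → HasDerivAt (fun s => S s (u s)) 0 s := fun s hs => by
    have := (hSd s).clm_apply (hu s hs)
    simpa using this
  have hwc : ContinuousOn (fun s => S s (u s)) (Set.Ici 0) := hSc.continuousOn.clm_apply hc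
  -- The equation is available only at positive times; the right derivative at 0 is recovered from
  -- continuity there and the limit of the derivatives.
  have h0 : HasDerivWithinAt (fun s => S s (u s)) 0 (Set.Ici 0) 0 := by
    refine hasDerivWithinAt_Ici_of_tendsto_deriv (s := Set.Ioi 0)
      (fun s hs => (hd s hs).differentiableAt.differentiableWithinAt)
      ((hwc 0 Set.self_mem_Ici).mono Set.Ioi_subset_Ici_self) self_mem_nhdsWithin ?_
    refine tendsto_const_nhds.congr' ?_
    filter_upwards [self_mem_nhdsWithin] with s hs using (hd s hs).deriv.symm
  have hconst : S t (u t) = S 0 (u 0) := by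
    refine constant_of_has_deriv_right_zero (f := fun s => S s (u s)) (a := 0) (b := t)
      (hwc.mono Set.Icc_subset_Ici_self) (fun s hs => ?_) t ⟨ht, le_rfl⟩
    rcases hs.1.eq_or_lt with h | h
    · rw [← h]; exact h0
    · exact (hd s h).hasDerivWithinAt
  have hS0 : S 0 = 1 := by simp [hS]
  rw [hS0, one_apply_eq_self] at hconst
  have hinv : NormedSpace.exp (t • A) * S t = 1 := by
    let : NormedAlgebra ℚ (E →L[ℝ] E) := NormedAlgebra.restrictScalars ℚ ℝ _
    rw [hS, ← NormedSpace.exp_add_of_commute]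
    · simp
    · exact (((Commute.refl A).neg_right).smul_left t).smul_right t
  calc u t = (NormedSpace.exp (t • A) * S t) (u t) := by rw [hinv]; rfl
    _ = _ := by rw [mul_apply_eq_comp, hconst]

namespace IsSolution

variable {J : Plane → ℝ} {d : ℝ} {H : Set Plane} {u₀ : Plane → ℝ} {u : ℝ → L1Plane}

theorem hasDerivAt (hu : IsSolution J H u₀ u) (hJ : IsKernel J d) (hH : MeasurableSet H)
    {t : ℝ} (ht : 0 < t) : HasDerivAt u ((hJ.killedAvg hH - 1) (u t)) t := by
  obtain ⟨v, hv, hve⟩ := hu.equation t ht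
  suffices h : v = (hJ.killedAvg hH - 1) (u t) from h ▸ hv
  have hvH : ∀ᵐ x : Plane, x ∈ H → v x = 0 := by
    -- The equation prescribes v only off H. Restriction to H is continuous and linear and sends the
    -- curve to 0 at positive times, so v vanishes on H.
    set R := LpToLpRestrictCLM Plane ℝ ℝ (volume : Measure Plane) 1 H
    have hR0 : ∀ s, 0 < s → R (u s) = 0 := fun s hs => by
      refine Lp.ext ?_
      refine (LpToLpRestrictCLM_coeFn ℝ H (u s)).trans (EventuallyEq.trans ?_
        (Lp.coeFn_zero ℝ 1 _).symm)
      exact (ae_restrict_iff' hH).2 (hu.zero_on_hole s hs)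
    have h1 : HasDerivAt (fun s => R (u s)) (R v) t := R.hasFDerivAt.comp_hasDerivAt t hv
    have h2 : HasDerivAt (fun s => R (u s)) 0 t :=
      (hasDerivAt_const t (0 : Lp ℝ 1 (volume.restrict H))).congr_of_eventuallyEq
        ((lt_mem_nhds ht).mono hR0)
    have h3 : (R v : Plane → ℝ) =ᵐ[volume.restrict H] 0 := by
      rw [h1.unique h2]; exact Lp.coeFn_zero ℝ 1 _
    exact (ae_restrict_iff' hH).1 ((LpToLpRestrictCLM_coeFn ℝ H v).symm.trans h3)
  refine Lp.ext ?_
  rw [sub_apply, one_apply_eq_self]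
  filter_upwards [hve, hvH, hu.zero_on_hole t ht, Lp.coeFn_sub (hJ.killedAvg hH (u t)) (u t),
    hJ.killedAvg_coeFn hH (u t)] with x h1 h2 h3 h4 h5
  rw [h4, Pi.sub_apply, h5]
  by_cases hx : x ∈ H
  · simp [hx, h2 hx, h3 hx]
  · simp [hx, h1 hx, nonlocalOp_eq]

/-- Scalars commute with P, so exp(t(P - 1)) = e^{-t} exp(tP), and the exponential series becomes an
average with Poisson weights. Norm summability is recorded for the later termwise integration. -/
theorem eq_exp (hu : IsSolution J H u₀ u) (hJ : IsKernel J d) (hH : MeasurableSet H)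
    {t : ℝ} (ht : 0 ≤ t) :
    u t = ∑' n : ℕ, (Real.exp (-t) * t ^ n / n.factorial) • (hJ.killedAvg hH ^ n) (u 0) ∧
      Summable fun n : ℕ =>
        ‖(Real.exp (-t) * t ^ n / n.factorial) • (hJ.killedAvg hH ^ n) (u 0)‖ := by
  set P := hJ.killedAvg hH
  have h1 := eq_exp_apply_of_hasDerivAt (P - 1) hu.continuousOn
    (fun t ht => hu.hasDerivAt hJ hH ht) ht
  have h2 : NormedSpace.exp (t • (P - 1)) = Real.exp (-t) • NormedSpace.exp (t • P) := by
    let : NormedAlgebra ℚ (L1Plane →L[ℝ] L1Plane) := NormedAlgebra.restrictScalars ℚ ℝ _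
    have : t • (P - 1) = algebraMap ℝ _ (-t) + t • P := by
      rw [Algebra.algebraMap_eq_smul_one, smul_sub, neg_smul]; abel
    rw [this, NormedSpace.exp_add_of_commute (Algebra.commutes _ _),
      ← NormedSpace.algebraMap_exp_comm, ← Real.exp_eq_exp_ℝ, ← Algebra.smul_def]
  have h3 : HasSum (fun n : ℕ => ((n.factorial : ℝ)⁻¹) • (t • P) ^ n)
      (NormedSpace.exp (t • P)) := NormedSpace.exp_series_hasSum_exp' (𝕂 := ℝ) (t • P)
  have h4 : HasSum (fun n : ℕ => (Real.exp (-t) * t ^ n / n.factorial) • (P ^ n) (u 0)) (u t) := by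
    rw [h1, h2]
    have := ((ContinuousLinearMap.apply ℝ L1Plane (u 0)).hasSum h3).const_smul (Real.exp (-t))
    convert this using 2 with n
    · simp only [ContinuousLinearMap.apply_apply, smul_pow, smul_apply, smul_smul]
      congr 1; ring
    · rfl
  refine ⟨h4.tsum_eq.symm, ?_⟩
  have h5 : Summable fun n : ℕ => Real.exp (-t) * ((t * ‖P‖) ^ n / n.factorial) * ‖u 0‖ :=
    ((Real.summable_pow_div_factorial _).mul_left _).mul_right _
  refine h5.of_nonneg_of_le (fun _ => norm_nonneg _) fun n => ?_
  rw [norm_smul, Real.norm_of_nonneg (by positivity)]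
  have h6 : ‖(P ^ n) (u 0)‖ ≤ ‖P‖ ^ n * ‖u 0‖ := by
    induction n with
    | zero => simp
    | succ n ih =>
      rw [pow_succ', mul_apply_eq_comp, pow_succ', mul_assoc]
      exact P.le_opNorm_of_le ih
  calc _ ≤ Real.exp (-t) * t ^ n / n.factorial * (‖P‖ ^ n * ‖u 0‖) := by gcongr
    _ = _ := by ring

end IsSolution

/-! ### Poisson averages of real sequences. -/

theorem hasSum_poisson_weights {t : ℝ} (ht : 0 ≤ t) :
    HasSum (fun n : ℕ => Real.exp (-t) * t ^ n / n.factorial) 1 :=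
  ProbabilityTheory.hasSum_one_poissonMeasure ⟨t, ht⟩

theorem summable_poisson_mul {b : ℕ → ℝ} {M : ℝ} (hb : ∀ n, |b n| ≤ M) {t : ℝ} (ht : 0 ≤ t) :
    Summable fun n : ℕ => Real.exp (-t) * t ^ n / n.factorial * b n := by
  refine ((hasSum_poisson_weights ht).summable.mul_right M).of_norm_bounded fun n => ?_
  rw [norm_mul, Real.norm_of_nonneg (by positivity)]
  exact mul_le_mul_of_nonneg_left (hb n) (by positivity)

/-- Poisson averages of a convergent sequence converge to its limit (regularity of Borel
summation). -/
theorem tendsto_tsum_poisson_mul {b : ℕ → ℝ} {l : ℝ} (hb : Tendsto b atTop (𝓝 l)) :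
    Tendsto (fun t : ℝ => ∑' n : ℕ, Real.exp (-t) * t ^ n / n.factorial * b n) atTop (𝓝 l) := by
  have hb0 : Tendsto (fun n => |b n - l|) atTop (𝓝 0) := by
    simpa using (hb.sub_const l).abs
  obtain ⟨M, hM⟩ := hb0.bddAbove_range
  obtain ⟨M', hM'⟩ := hb.abs.bddAbove_range
  have hM : ∀ n, |b n - l| ≤ M := fun n => hM ⟨n, rfl⟩
  have hM' : ∀ n, |b n| ≤ M' := fun n => hM' ⟨n, rfl⟩
  have hM0 : 0 ≤ M := (abs_nonneg _).trans (hM 0)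
  rw [Metric.tendsto_atTop']
  intro ε hε
  obtain ⟨N, hN⟩ := eventually_atTop.1 (hb0.eventually (gt_mem_nhds (half_pos hε)))
  -- Any fixed finite set of Poisson weights vanishes as t → ∞, so the first N terms, bounded only
  -- by M, do not count.
  have hlim : Tendsto (fun t : ℝ => (∑ n ∈ Finset.range N,
      Real.exp (-t) * t ^ n / n.factorial) * M) atTop (𝓝 0) := by
    have : Tendsto (fun t : ℝ => ∑ n ∈ Finset.range N,
        Real.exp (-t) * t ^ n / n.factorial) atTop (𝓝 (∑ n ∈ Finset.range N, (0 : ℝ))) := by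
      refine tendsto_finsetSum _ fun n _ => ?_
      have := (Real.tendsto_pow_mul_exp_neg_atTop_nhds_zero n).div_const (n.factorial : ℝ)
      simpa [mul_comm] using this
    simpa using this.mul_const M
  obtain ⟨T, hT⟩ := eventually_atTop.1 (hlim.eventually (gt_mem_nhds (half_pos hε)))
  refine ⟨max T 0, fun t ht => ?_⟩
  have ht0 : 0 ≤ t := (le_max_right _ _).trans ht.le
  have hp := hasSum_poisson_weights ht0
  set p : ℕ → ℝ := fun n => Real.exp (-t) * t ^ n / n.factorial with hpdef
  have hp0 : ∀ n, 0 ≤ p n := fun n => by positivity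
  have hsum : Summable fun n => p n * (b n - l) := by
    refine summable_poisson_mul (M := M) hM ht0
  have habs : Summable fun n => p n * |b n - l| := by
    refine summable_poisson_mul (M := M) (fun n => by simpa using hM n) ht0
  have h1 : ∑' n, p n * b n - l = ∑' n, p n * (b n - l) := by
    have h := (summable_poisson_mul hM' ht0).tsum_sub (hp.summable.mul_right l)
    rw [tsum_mul_right, hp.tsum_eq, one_mul] at h
    rw [← h]
    simp only [mul_sub, hpdef]
  have h2 : HasSum (fun n => p n * (ε / 2) + if n ∈ Finset.range N then p n * M else 0)
      (1 * (ε / 2) + ∑ n ∈ Finset.range N, if n ∈ Finset.range N then p n * M else 0) :=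
    (hp.mul_right _).add (hasSum_sum_of_ne_finset_zero fun n hn => if_neg hn)
  rw [Real.dist_eq, h1]
  calc |∑' n, p n * (b n - l)| ≤ ∑' n, p n * |b n - l| := by
        have h := norm_tsum_le_tsum_norm hsum.norm
        simpa only [Real.norm_eq_abs, abs_mul, abs_of_nonneg (hp0 _)] using h
    _ ≤ 1 * (ε / 2) + ∑ n ∈ Finset.range N, if n ∈ Finset.range N then p n * M else 0 := by
        rw [← h2.tsum_eq]
        refine habs.tsum_le_tsum (fun n => ?_) h2.summable
        split_ifs with hn
        · have := mul_le_mul_of_nonneg_left (hM n) (hp0 n)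
          have := mul_nonneg (hp0 n) (half_pos hε).le
          linarith
        · have := hN n (by simpa using hn)
          simpa using mul_le_mul_of_nonneg_left this.le (hp0 n)
    _ = ε / 2 + (∑ n ∈ Finset.range N, p n) * M := by
        rw [one_mul, Finset.sum_mul]
        congr 1
        exact Finset.sum_congr rfl fun n hn => if_pos hn
    _ < ε := by
        have := hT t ((le_max_left _ _).trans ht.le)
        linarith

/-! ### The logarithmic weight and bounds on the stationary solution. -/

/-- The weight `log(2 + |x|)`. -/
noncomputable def logWeight (x : Plane) : ℝ := Real.log (2 + ‖x‖)

theorem log_two_le_logWeight (x : Plane) : Real.log 2 ≤ logWeight x :=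
  Real.log_le_log two_pos (by linarith [norm_nonneg x])

theorem continuous_logWeight : Continuous logWeight :=
  (continuous_const.add continuous_norm).log fun x =>
    (add_pos_of_pos_of_nonneg two_pos (norm_nonneg x)).ne'

/-- A jump shorter than d adds at most log(1 + d) to the weight; the lower bound log 2 turns this
additive error into a factor. This is the hypothesis on w in `IsKernel.integrable_prod`. -/
theorem logWeight_le_mul {d : ℝ} (hd : 0 ≤ d) {x y : Plane} (h : ‖x - y‖ < d) :
    logWeight x ≤ (1 + Real.log (1 + d) / Real.log 2) * logWeight y := by
  have h2 : 0 < Real.log 2 := Real.log_pos one_lt_two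
  have hy := norm_nonneg y
  have h3 : 2 + ‖x‖ ≤ (2 + ‖y‖) * (1 + d) := by
    have := norm_le_norm_add_norm_sub' x y
    nlinarith
  have h4 : logWeight x ≤ logWeight y + Real.log (1 + d) := by
    rw [logWeight, logWeight, ← Real.log_mul (by positivity) (by positivity)]
    exact Real.log_le_log (by positivity) h3
  have h5 : Real.log (1 + d) ≤ Real.log (1 + d) / Real.log 2 * logWeight y := by
    have := mul_le_mul_of_nonneg_left (log_two_le_logWeight y)
      (div_nonneg (Real.log_nonneg (by linarith : 1 ≤ 1 + d)) h2.le)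
    rwa [div_mul_cancel₀ _ h2.ne'] at this
  linarith

theorem log_norm_le_logWeight {x : Plane} (hx : 2 ≤ ‖x‖) : Real.log ‖x‖ ≤ logWeight x :=
  Real.log_le_log (by linarith) (by linarith)

/-- For |x| ≥ 2, 2 + |x| ≤ |x|². -/
theorem logWeight_le_two_mul_log {x : Plane} (hx : 2 ≤ ‖x‖) :
    logWeight x ≤ 2 * Real.log ‖x‖ := by
  rw [logWeight, ← Real.log_rpow (by linarith), Real.rpow_two]
  exact Real.log_le_log (by linarith) (by nlinarith)

theorem IsHole.two_le_norm {H : Set Plane} (hH : IsHole H) {x : Plane} (hx : x ∉ H) :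
    2 ≤ ‖x‖ := by
  by_contra! h
  exact hx (hH.ball_subset (by simpa using h))

namespace IsLogStationary

variable {J : Plane → ℝ} {H : Set Plane} {φ : Plane → ℝ}

theorem exists_abs_sub_log_le (hφ : IsLogStationary J H φ) (hH : MeasurableSet H) :
    ∃ C : ℝ, 0 ≤ C ∧ ∀ᵐ x : Plane, x ∉ H → |φ x - Real.log ‖x‖| ≤ C := by
  have h := ae_le_eLpNormEssSup (f := fun x : Plane => φ x - Real.log ‖x‖)
    (μ := volume.restrict Hᶜ)
  have hfin := hφ.log_behavior.2
  rw [eLpNorm_exponent_top] at hfin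
  refine ⟨(eLpNormEssSup (fun x : Plane => φ x - Real.log ‖x‖) (volume.restrict Hᶜ)).toReal,
    ENNReal.toReal_nonneg, ?_⟩
  filter_upwards [(ae_restrict_iff' hH.compl).1 h] with x hx hxH
  have := ENNReal.toReal_mono hfin.ne (hx hxH)
  simpa using this

theorem aestronglyMeasurable (hφ : IsLogStationary J H φ) (hH : MeasurableSet H) :
    AEStronglyMeasurable φ volume := by
  have hlog : Measurable fun x : Plane => Real.log ‖x‖ := by fun_prop
  have h1 : AEStronglyMeasurable φ (volume.restrict Hᶜ) := by
    have := hφ.log_behavior.1.add hlog.aestronglyMeasurable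
    simpa [Pi.add_def] using this
  have h2 : AEStronglyMeasurable φ (volume.restrict H) :=
    aestronglyMeasurable_const.congr
      ((ae_restrict_iff' hH).2 (hφ.zero_on_hole.mono fun x hx h => (hx h).symm) :
        (fun _ => (0 : ℝ)) =ᵐ[volume.restrict H] φ)
  have := aestronglyMeasurable_union_iff.2 ⟨h2, h1⟩
  simpa using this

theorem exists_abs_le_mul_logWeight (hφ : IsLogStationary J H φ) (hH : IsHole H) :
    ∃ C : ℝ, 0 ≤ C ∧ ∀ᵐ x : Plane, |φ x| ≤ C * logWeight x := by
  obtain ⟨C, hC0, hC⟩ := hφ.exists_abs_sub_log_le hH.isOpen.measurableSet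
  have h2 : 0 < Real.log 2 := Real.log_pos one_lt_two
  -- The 1 pays for log|x|, and C / log 2 absorbs the bounded difference since the weight is at
  -- least log 2.
  refine ⟨1 + C / Real.log 2, by positivity, ?_⟩
  filter_upwards [hC, hφ.zero_on_hole] with x h h0
  have hw := log_two_le_logWeight x
  by_cases hx : x ∈ H
  · rw [h0 hx, abs_zero]
    exact mul_nonneg (by positivity) (h2.le.trans hw)
  have hx2 := hH.two_le_norm hx
  have h3 : C ≤ C / Real.log 2 * logWeight x := by
    have := mul_le_mul_of_nonneg_left hw (div_nonneg hC0 h2.le)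
    rwa [div_mul_cancel₀ _ h2.ne'] at this
  have h4 := log_norm_le_logWeight hx2
  have h5 : 0 ≤ Real.log ‖x‖ := Real.log_nonneg (by linarith)
  have h6 := abs_le.1 (h hx)
  rw [abs_le]
  constructor <;> linarith [h6.1, h6.2]

end IsLogStationary

/-! ### Densities with logarithmic moment, conservation of ∫ fφ and mass balance. -/

/-- Densities that evolve outside the hole: nonnegative, zero on `H`, with a finite logarithmic
moment. -/
structure IsLogDensity (H : Set Plane) (f : L1Plane) : Prop where
  nonneg : ∀ᵐ x : Plane, 0 ≤ f x
  zero_on_hole : ∀ᵐ x : Plane, x ∈ H → f x = 0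
  integrable_mul_logWeight : Integrable fun x : Plane => f x * logWeight x

namespace IsLogDensity

variable {J : Plane → ℝ} {d : ℝ} {H : Set Plane} {f : L1Plane} {φ : Plane → ℝ}

theorem mul_log_nonneg (hf : IsLogDensity H f) (hH : IsHole H) :
    ∀ᵐ x : Plane, 0 ≤ f x * Real.log ‖x‖ := by
  filter_upwards [hf.nonneg, hf.zero_on_hole] with x h1 h2
  by_cases hx : x ∈ H
  · simp [h2 hx]
  · exact mul_nonneg h1 (Real.log_nonneg (by linarith [hH.two_le_norm hx]))

/-- The bound on g is asked only off H, where f lives: log|x| is unbounded near the origin, which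
lies in H. -/
theorem integrable_mul_of_abs_le (hf : IsLogDensity H f) {g : Plane → ℝ}
    (hg : AEStronglyMeasurable g volume) {C : ℝ}
    (hC : ∀ᵐ x : Plane, x ∉ H → |g x| ≤ C * logWeight x) :
    Integrable fun x : Plane => f x * g x := by
  refine (hf.integrable_mul_logWeight.const_mul C).mono
    ((L1.integrable_coeFn f).1.mul hg) ?_
  filter_upwards [hC, hf.zero_on_hole] with x h1 h2
  by_cases hx : x ∈ H
  · simp [h2 hx]
  · calc ‖f x * g x‖ ≤ |f x| * (C * logWeight x) := by
          rw [norm_mul, Real.norm_eq_abs, Real.norm_eq_abs]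
          exact mul_le_mul_of_nonneg_left (h1 hx) (abs_nonneg _)
      _ ≤ |f x| * |C * logWeight x| := by gcongr; exact le_abs_self _
      _ = ‖C * (f x * logWeight x)‖ := by
          simp only [Real.norm_eq_abs, abs_mul]; ring

theorem integrable_mul_log (hf : IsLogDensity H f) (hH : IsHole H) :
    Integrable fun x : Plane => f x * Real.log ‖x‖ := by
  have hlog : Measurable fun x : Plane => Real.log ‖x‖ := by fun_prop
  refine hf.integrable_mul_of_abs_le (C := 1) hlog.aestronglyMeasurable
    (Eventually.of_forall fun x hx => ?_)
  have hx2 := hH.two_le_norm hx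
  rw [abs_of_nonneg (Real.log_nonneg (by linarith)), one_mul]
  exact log_norm_le_logWeight hx2

theorem killedAvg (hf : IsLogDensity H f) (hJ : IsKernel J d) (hH : MeasurableSet H) :
    IsLogDensity H (hJ.killedAvg hH f) where
  nonneg := by
    filter_upwards [hJ.killedAvg_coeFn hH f] with x hx
    rw [hx]
    exact Set.indicator_nonneg (fun _ _ => hJ.kernelAvg_nonneg hf.nonneg _) _
  zero_on_hole := by
    filter_upwards [hJ.killedAvg_coeFn hH f] with x hx hxH
    rw [hx, Set.indicator_of_notMem (by simpa using hxH)]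
  integrable_mul_logWeight := by
    have h := hJ.integrable_kernelAvg_mul (w := logWeight) (g := logWeight) (C := 1)
      (fun x y => logWeight_le_mul hJ.range_pos.le) (L1.integrable_coeFn f).1
      hf.integrable_mul_logWeight continuous_logWeight.aestronglyMeasurable zero_le_one
      (Eventually.of_forall fun x => by
        rw [abs_of_nonneg ((Real.log_pos one_lt_two).le.trans (log_two_le_logWeight x)), one_mul])
    refine (h.indicator hH.compl).congr ?_
    filter_upwards [hJ.killedAvg_coeFn hH f] with x hx
    rw [hx]
    by_cases hxH : x ∈ Hᶜ
    · simp only [Set.indicator_of_mem hxH]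
    · simp only [Set.indicator_of_notMem hxH, zero_mul]

theorem killedAvg_pow (hf : IsLogDensity H f) (hJ : IsKernel J d) (hH : MeasurableSet H)
    (n : ℕ) : IsLogDensity H ((hJ.killedAvg hH ^ n) f) := by
  induction n with
  | zero => simpa using hf
  | succ n ih =>
    rw [pow_succ', mul_apply_eq_comp]
    exact ih.killedAvg hJ hH

theorem integrable_mul_logStationary (hf : IsLogDensity H f) (hH : IsHole H)
    (hφ : IsLogStationary J H φ) : Integrable fun x : Plane => f x * φ x := by
  obtain ⟨C, -, hC⟩ := hφ.exists_abs_le_mul_logWeight hH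
  exact hf.integrable_mul_of_abs_le (hφ.aestronglyMeasurable hH.isOpen.measurableSet)
    (hC.mono fun _ h _ => h)

/-- Integrals against `φ` are conserved. -/
theorem integral_killedAvg_mul (hf : IsLogDensity H f) (hJ : IsKernel J d) (hH : IsHole H)
    (hφ : IsLogStationary J H φ) :
    ∫ x, hJ.killedAvg hH.isOpen.measurableSet f x * φ x = ∫ x, f x * φ x := by
  obtain ⟨C, hC0, hC⟩ := hφ.exists_abs_le_mul_logWeight hH
  have h := hJ.integral_kernelAvg_mul (fun x y => logWeight_le_mul hJ.range_pos.le)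
    (L1.integrable_coeFn f).1 hf.integrable_mul_logWeight
    (hφ.aestronglyMeasurable hH.isOpen.measurableSet) hC0 hC
  refine Eq.trans (integral_congr_ae ?_) (h.trans (integral_congr_ae ?_))
  -- Killing is invisible to φ, which vanishes on H; in the second goal f vanishes on H, so
  -- Jφ-averages are needed only where Lφ = 0.
  · filter_upwards [hJ.killedAvg_coeFn hH.isOpen.measurableSet f, hφ.zero_on_hole] with x h1 h2
    by_cases hx : x ∈ H
    · simp [h2 hx]
    · rw [h1, Set.indicator_of_mem (by simpa using hx)]
  · filter_upwards [hf.zero_on_hole, hφ.equation] with x h1 h2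
    by_cases hx : x ∈ H
    · simp [h1 hx]
    · have := h2 hx
      rw [nonlocalOp_eq, sub_eq_zero] at this
      simp only [this]

theorem integral_killedAvg_pow_mul (hf : IsLogDensity H f) (hJ : IsKernel J d) (hH : IsHole H)
    (hφ : IsLogStationary J H φ) (n : ℕ) :
    ∫ x, (hJ.killedAvg hH.isOpen.measurableSet ^ n) f x * φ x = ∫ x, f x * φ x := by
  induction n with
  | zero => simp
  | succ n ih =>
    rw [pow_succ', mul_apply_eq_comp,
      (hf.killedAvg_pow hJ _ n).integral_killedAvg_mul hJ hH hφ, ih]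

/-- The logarithmic moment and the integral against `φ` differ by at most a multiple of the
mass. -/
theorem abs_integral_mul_log_sub_le (hf : IsLogDensity H f) (hH : IsHole H)
    (hφ : IsLogStationary J H φ) {C : ℝ}
    (hC : ∀ᵐ x : Plane, x ∉ H → |φ x - Real.log ‖x‖| ≤ C) :
    |(∫ x : Plane, f x * Real.log ‖x‖) - ∫ x : Plane, f x * φ x| ≤ C * ∫ x : Plane, f x := by
  rw [← integral_sub (hf.integrable_mul_log hH) (hf.integrable_mul_logStationary hH hφ),
    ← integral_const_mul]
  rw [← Real.norm_eq_abs]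
  refine norm_integral_le_of_norm_le ((L1.integrable_coeFn f).const_mul C) ?_
  filter_upwards [hf.nonneg, hf.zero_on_hole, hC] with x h1 h2 h3
  by_cases hx : x ∈ H
  · simp [h2 hx]
  · rw [← mul_sub, norm_mul, Real.norm_of_nonneg h1, mul_comm C, norm_sub_rev]
    exact mul_le_mul_of_nonneg_left (h3 hx) h1

/-- Mass balance: what is lost is what jumps into the hole. -/
theorem integral_killedAvg_add (hJ : IsKernel J d) (hH : MeasurableSet H) (f : L1Plane) :
    (∫ x, hJ.killedAvg hH f x) + ∫ x in H, kernelAvg J f x = ∫ x, f x := by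
  have hi := hJ.integrable_kernelAvg (L1.integrable_coeFn f)
  rw [integral_congr_ae (hJ.killedAvg_coeFn hH f), integral_indicator hH.compl, add_comm,
    integral_add_compl hH hi, hJ.integral_kernelAvg (L1.integrable_coeFn f)]

end IsLogDensity

/-! ### Absorption of all mass by the hole. -/

/-- Averages of the indicator of a ball are bounded below on a larger ball. -/
theorem IsKernel.exists_le_kernelAvg_ball {J : Plane → ℝ} {d : ℝ} (hJ : IsKernel J d) {r : ℝ}
    (hr : 0 < r) : ∃ c : ℝ, 0 < c ∧ ∀ y : Plane, ‖y‖ ≤ r + d / 2 →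
      c ≤ kernelAvg J ((Metric.ball 0 r).indicator fun _ => 1) y := by
  have hd := hJ.range_pos
  set g : Plane → ℝ := (Metric.ball 0 r).indicator fun _ => 1 with hg
  have hgi : Integrable g := by
    refine (integrable_indicator_iff measurableSet_ball).2 (integrableOn_const ?_)
    exact measure_ball_lt_top.ne
  have hg0 : ∀ x, 0 ≤ g x := fun x => Set.indicator_nonneg (fun _ _ => zero_le_one) x
  have hcont : Continuous (kernelAvg J g) := by
    have h := hJ.hasCompactSupport.continuous_convolution_left (ContinuousLinearMap.lsmul ℝ ℝ)
      hJ.contDiff.continuous hgi.locallyIntegrable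
    have h2 : convolution J g (ContinuousLinearMap.lsmul ℝ ℝ) volume = kernelAvg J g :=
      funext fun x => convolution_lsmul_swap
    rwa [h2] at h
  have hpos : ∀ y : Plane, ‖y‖ ≤ r + d / 2 → 0 < kernelAvg J g y := by
    intro y hy
    rw [kernelAvg, integral_pos_iff_support_of_nonneg
      (fun x => mul_nonneg (hJ.nonneg _) (hg0 x)) (hJ.integrable_mul_of_integrable hgi y)]
    have hsub : Metric.ball y d ∩ Metric.ball 0 r ⊆
        Function.support fun x => J (y - x) * g x := by
      rintro x ⟨hx1, hx2⟩
      have h1 : 0 < J (y - x) := hJ.pos _ (by rwa [← dist_eq_norm, dist_comm])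
      rw [Function.mem_support, hg, Set.indicator_of_mem hx2, mul_one]
      exact h1.ne'
    refine lt_of_lt_of_le ?_ (measure_mono hsub)
    refine (Metric.isOpen_ball.inter Metric.isOpen_ball).measure_pos _ ?_
    have hrd : 0 < r + d := by positivity
    -- This point divides the segment from 0 to y in the ratio r : d; it lies in both open balls
    -- because |y| ≤ r + d/2 < r + d.
    refine ⟨(r / (r + d)) • y, ?_, ?_⟩
    · rw [Metric.mem_ball, dist_comm, dist_eq_norm]
      have : y - (r / (r + d)) • y = (d / (r + d)) • y := by
        rw [show d / (r + d) = 1 - r / (r + d) by field_simp; ring, sub_smul, one_smul]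
      rw [this, norm_smul, Real.norm_of_nonneg (by positivity), div_mul_eq_mul_div, div_lt_iff₀ hrd]
      nlinarith
    · rw [mem_ball_zero_iff, norm_smul, Real.norm_of_nonneg (by positivity), div_mul_eq_mul_div,
        div_lt_iff₀ hrd]
      nlinarith
  obtain ⟨y₀, hy₀, hmin⟩ := (isCompact_closedBall (0 : Plane) (r + d / 2)).exists_isMinOn
    ⟨0, by simp; positivity⟩ hcont.continuousOn
  exact ⟨_, hpos y₀ (by simpa using hy₀), fun y hy => hmin (by simpa using hy)⟩

namespace IsLogDensity

variable {J : Plane → ℝ} {d : ℝ} {H : Set Plane} {f : L1Plane} {φ : Plane → ℝ}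

/-- Mass in the ball of radius `r + d / 2` is controlled by what jumps from it into the hole or
into the smaller ball. -/
theorem mul_setIntegral_ball_le (hf : IsLogDensity H f) (hJ : IsKernel J d)
    (hH : MeasurableSet H) {r c : ℝ} (hc : ∀ y : Plane, ‖y‖ ≤ r + d / 2 →
      c ≤ kernelAvg J ((Metric.ball 0 r).indicator fun _ => 1) y) :
    c * ∫ x in Metric.ball 0 (r + d / 2), f x ≤
      (∫ x in H, kernelAvg J f x) + ∫ x in Metric.ball 0 r, hJ.killedAvg hH f x := by
  have hfi := L1.integrable_coeFn f
  have hi := hJ.integrable_kernelAvg hfi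
  have hPi := L1.integrable_coeFn (hJ.killedAvg hH f)
  set g : Plane → ℝ := (Metric.ball 0 r).indicator fun _ => 1 with hg
  have hg1 : ∀ x, |g x| ≤ 1 := fun x => by
    by_cases hx : x ∈ Metric.ball (0 : Plane) r
    · simp [hg, Set.indicator_of_mem hx]
    · simp [hg, Set.indicator_of_notMem hx]
  have hg0 : ∀ x, 0 ≤ g x := fun x => Set.indicator_nonneg (fun _ _ => zero_le_one) x
  have hgm : AEStronglyMeasurable g volume :=
    aestronglyMeasurable_const.indicator measurableSet_ball
  have hfg : Integrable fun x => f x * kernelAvg J g x := by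
    have := hJ.integrable_prod (w := fun _ => 1) (g := g) (K := 1) (C := 1) (by simp) hfi.1
      (by simpa using hfi) hgm zero_le_one (by simpa using Eventually.of_forall hg1)
    refine this.integral_prod_right.congr (Eventually.of_forall fun y => ?_)
    simp only [kernelAvg, ← integral_const_mul]
    congr 1; ext x
    rw [hJ.even y x]; ring
  calc c * ∫ x in Metric.ball 0 (r + d / 2), f x
      = ∫ x, (Metric.ball 0 (r + d / 2)).indicator (fun x => c * f x) x := by
        rw [integral_indicator measurableSet_ball, integral_const_mul]
    _ ≤ ∫ x, f x * kernelAvg J g x := by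
        refine integral_mono_ae ((hfi.const_mul c).indicator measurableSet_ball) hfg ?_
        filter_upwards [hf.nonneg] with x hx
        by_cases hxb : x ∈ Metric.ball (0 : Plane) (r + d / 2)
        · rw [Set.indicator_of_mem hxb, mul_comm]
          exact mul_le_mul_of_nonneg_left (hc x (mem_ball_zero_iff.1 hxb).le) hx
        · rw [Set.indicator_of_notMem hxb]
          exact mul_nonneg hx (hJ.kernelAvg_nonneg (Eventually.of_forall hg0) x)
    _ = ∫ x, kernelAvg J f x * g x :=
        (hJ.integral_kernelAvg_mul_of_bounded hfi hgm zero_le_one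
          (Eventually.of_forall hg1)).symm
    -- Mass landing in B_r either lands in H, and is counted by the first term, or survives as part
    -- of Pf in B_r.
    _ ≤ ∫ x, (H.indicator (kernelAvg J f) x +
          (Metric.ball 0 r).indicator (hJ.killedAvg hH f) x) := by
        refine integral_mono_ae (hi.mul_bdd (c := 1) hgm (Eventually.of_forall hg1))
          ((hi.indicator hH).add (hPi.indicator measurableSet_ball)) ?_
        filter_upwards [hJ.killedAvg_coeFn hH f] with x hx
        have h0 := hJ.kernelAvg_nonneg hf.nonneg x
        by_cases hxH : x ∈ H <;> by_cases hxb : x ∈ Metric.ball (0 : Plane) r <;>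
          simp [hg, hx, hxH, Set.indicator, hxb, h0]
    _ = _ := by
        rw [integral_add (hi.indicator hH) (hPi.indicator measurableSet_ball),
          integral_indicator hH, integral_indicator measurableSet_ball]

theorem setIntegral_nonneg (hf : IsLogDensity H f) (s : Set Plane) : 0 ≤ ∫ x in s, f x :=
  integral_nonneg_of_ae (ae_restrict_of_ae hf.nonneg)

theorem integral_nonneg (hf : IsLogDensity H f) : 0 ≤ ∫ x, f x :=
  integral_nonneg_of_ae hf.nonneg

/-- The total mass that ever jumps into the hole is finite. -/
theorem summable_setIntegral_kernelAvg (hf : IsLogDensity H f) (hJ : IsKernel J d)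
    (hH : MeasurableSet H) :
    Summable fun n : ℕ => ∫ x in H, kernelAvg J ((hJ.killedAvg hH ^ n) f) x := by
  refine summable_of_sum_range_le (c := ∫ x, f x)
    (fun n => integral_nonneg_of_ae (Eventually.of_forall fun x =>
      hJ.kernelAvg_nonneg (hf.killedAvg_pow hJ hH n).nonneg x)) fun N => ?_
  -- The mass balance telescopes: absorbed mass is initial mass minus surviving mass.
  have key : ∑ n ∈ Finset.range N, ∫ x in H, kernelAvg J ((hJ.killedAvg hH ^ n) f) x =
      (∫ x, f x) - ∫ x, (hJ.killedAvg hH ^ N) f x := by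
    induction N with
    | zero => simp
    | succ N ih =>
      have := integral_killedAvg_add hJ hH ((hJ.killedAvg hH ^ N) f)
      rw [Finset.sum_range_succ, ih, pow_succ' _ N, mul_apply_eq_comp]
      linarith
  have := (hf.killedAvg_pow hJ hH N).integral_nonneg
  linarith

/-- The total time spent in a ball is finite. -/
theorem summable_setIntegral_ball (hf : IsLogDensity H f) (hJ : IsKernel J d) (hH : IsHole H)
    (k : ℕ) : Summable fun n : ℕ => ∫ x in Metric.ball 0 (2 + k * (d / 2)),
      (hJ.killedAvg hH.isOpen.measurableSet ^ n) f x := by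
  have hm := hH.isOpen.measurableSet
  induction k with
  | zero =>
    convert summable_zero (α := ℝ) (β := ℕ) using 2 with n
    have h := (hf.killedAvg_pow hJ hm n).zero_on_hole
    refine setIntegral_eq_zero_of_ae_eq_zero ?_
    filter_upwards [h] with x hx hxb
    exact hx (hH.ball_subset (by simpa using hxb))
  | succ k ih =>
    have hd := hJ.range_pos
    obtain ⟨c, hc0, hc⟩ := hJ.exists_le_kernelAvg_ball (r := 2 + k * (d / 2)) (by positivity)
    -- The smaller ball is charged one step later, hence the shift of the inductive series by one.
    have hs := (((hf.summable_setIntegral_kernelAvg hJ hm).add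
      ((summable_nat_add_iff 1).2 ih)).mul_left c⁻¹)
    refine hs.of_nonneg_of_le (fun n => (hf.killedAvg_pow hJ hm n).setIntegral_nonneg _)
      fun n => ?_
    have h := (hf.killedAvg_pow hJ hm n).mul_setIntegral_ball_le hJ hm hc
    have hr : 2 + ((k + 1 : ℕ) : ℝ) * (d / 2) = 2 + k * (d / 2) + d / 2 := by push_cast; ring
    rw [le_inv_mul_iff₀ hc0, pow_succ', mul_apply_eq_comp, hr]
    exact h

/-- The mass is bounded by its part in a ball and the logarithmic moment. -/
theorem integral_le_setIntegral_ball_add (hf : IsLogDensity H f) (hH : IsHole H) {R : ℝ}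
    (hR : 1 < R) : ∫ x, f x ≤ (∫ x in Metric.ball 0 R, f x) +
      (Real.log R)⁻¹ * ∫ x : Plane, f x * Real.log ‖x‖ := by
  have hfi := L1.integrable_coeFn f
  have hl : 0 < Real.log R := Real.log_pos hR
  rw [← integral_indicator measurableSet_ball, ← integral_const_mul, ← integral_add
    (hfi.indicator measurableSet_ball) ((hf.integrable_mul_log hH).const_mul _)]
  refine integral_mono_ae hfi ((hfi.indicator measurableSet_ball).add
    ((hf.integrable_mul_log hH).const_mul _)) ?_
  filter_upwards [hf.nonneg, hf.mul_log_nonneg hH] with x h1 h2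
  by_cases hx : x ∈ Metric.ball (0 : Plane) R
  · rw [Set.indicator_of_mem hx]
    exact le_add_of_nonneg_right (mul_nonneg (inv_nonneg.2 hl.le) h2)
  · rw [Set.indicator_of_notMem hx, zero_add, le_inv_mul_iff₀ hl, mul_comm]
    refine mul_le_mul_of_nonneg_left (Real.log_le_log (by linarith) ?_) h1
    simpa using hx

theorem integral_killedAvg_pow_le (hf : IsLogDensity H f) (hJ : IsKernel J d)
    (hH : MeasurableSet H) (n : ℕ) : ∫ x, (hJ.killedAvg hH ^ n) f x ≤ ∫ x, f x := by
  induction n with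
  | zero => simp
  | succ n ih =>
    have h := integral_killedAvg_add hJ hH ((hJ.killedAvg hH ^ n) f)
    have h0 : 0 ≤ ∫ x in H, kernelAvg J ((hJ.killedAvg hH ^ n) f) x :=
      integral_nonneg_of_ae (Eventually.of_forall fun x =>
        hJ.kernelAvg_nonneg (hf.killedAvg_pow hJ hH n).nonneg x)
    rw [pow_succ', mul_apply_eq_comp]
    linarith

/-- All the mass is eventually absorbed by the hole. -/
theorem tendsto_integral_killedAvg_pow (hf : IsLogDensity H f) (hJ : IsKernel J d)
    (hH : IsHole H) (hφ : IsLogStationary J H φ) :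
    Tendsto (fun n : ℕ => ∫ x, (hJ.killedAvg hH.isOpen.measurableSet ^ n) f x) atTop (𝓝 0) := by
  have hm := hH.isOpen.measurableSet
  obtain ⟨C, hC0, hC⟩ := hφ.exists_abs_sub_log_le hm
  set a : ℕ → L1Plane := fun n => (hJ.killedAvg hm ^ n) f
  have ha : ∀ n, IsLogDensity H (a n) := hf.killedAvg_pow hJ hm
  -- Uniform bound for the logarithmic moments: the conserved integral plus C times the initial
  -- mass, which dominates every later mass.
  set M : ℝ := |∫ x, f x * φ x| + C * ∫ x, f x with hM
  have hM0 : 0 ≤ M := add_nonneg (abs_nonneg _) (mul_nonneg hC0 hf.integral_nonneg)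
  have hbound : ∀ n, ∫ x : Plane, a n x * Real.log ‖x‖ ≤ M := fun n => by
    have h1 := (abs_le.1 ((ha n).abs_integral_mul_log_sub_le hH hφ hC)).2
    rw [hf.integral_killedAvg_pow_mul hJ hH hφ n] at h1
    have h2 := mul_le_mul_of_nonneg_left (hf.integral_killedAvg_pow_le hJ hm n) hC0
    have h3 := le_abs_self (∫ x, f x * φ x)
    linarith
  have hd := hJ.range_pos
  rw [Metric.tendsto_atTop']
  intro ε hε
  have hR : Tendsto (fun k : ℕ => (Real.log (2 + k * (d / 2)))⁻¹ * M) atTop (𝓝 0) := by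
    have h1 : Tendsto (fun k : ℕ => 2 + (k : ℝ) * (d / 2)) atTop atTop :=
      tendsto_atTop_add_const_left _ _
        (tendsto_natCast_atTop_atTop.atTop_mul_const (half_pos hd))
    simpa using (Real.tendsto_log_atTop.comp h1).inv_tendsto_atTop.mul_const M
  obtain ⟨k, hk⟩ := (hR.eventually (gt_mem_nhds (half_pos hε))).exists
  have hball := (hf.summable_setIntegral_ball hJ hH k).tendsto_atTop_zero
  obtain ⟨N, hN⟩ := eventually_atTop.1 (hball.eventually (gt_mem_nhds (half_pos hε)))
  refine ⟨N, fun n hn => ?_⟩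
  have hR1 : 1 < 2 + (k : ℝ) * (d / 2) := by
    have : 0 ≤ (k : ℝ) * (d / 2) := by positivity
    linarith
  rw [Real.dist_eq, sub_zero, abs_of_nonneg (ha n).integral_nonneg]
  have h1 := (ha n).integral_le_setIntegral_ball_add hH hR1
  have h2 := mul_le_mul_of_nonneg_left (hbound n) (inv_nonneg.2 (Real.log_pos hR1).le)
  have h3 : ∫ x in Metric.ball 0 (2 + k * (d / 2)), a n x < ε / 2 := hN n hn.le
  linarith

/-- The distance to the conserved value ∫ fφ is at most C times the remaining mass, which tends to
zero. -/
theorem tendsto_integral_killedAvg_pow_mul_log (hf : IsLogDensity H f) (hJ : IsKernel J d)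
    (hH : IsHole H) (hφ : IsLogStationary J H φ) :
    Tendsto (fun n : ℕ => ∫ x : Plane,
      (hJ.killedAvg hH.isOpen.measurableSet ^ n) f x * Real.log ‖x‖) atTop
      (𝓝 (∫ x, f x * φ x)) := by
  obtain ⟨C, -, hC⟩ := hφ.exists_abs_sub_log_le hH.isOpen.measurableSet
  rw [tendsto_iff_norm_sub_tendsto_zero]
  refine squeeze_zero (fun _ => norm_nonneg _) (fun n => ?_)
    (by simpa only [mul_zero] using (hf.tendsto_integral_killedAvg_pow hJ hH hφ).const_mul C)
  have h := (hf.killedAvg_pow hJ hH.isOpen.measurableSet n).abs_integral_mul_log_sub_le hH hφ hC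
  rwa [hf.integral_killedAvg_pow_mul hJ hH hφ n] at h

end IsLogDensity

/-! ### From discrete steps back to continuous time. -/

theorem IsSolution.isLogDensity_initial {J : Plane → ℝ} {H : Set Plane} {u₀ : Plane → ℝ}
    {u : ℝ → L1Plane} (hu : IsSolution J H u₀ u) (hu₀ : IsInitialDatum H u₀) (hH : IsHole H) :
    IsLogDensity H (u 0) where
  nonneg := by
    filter_upwards [hu.initial, hu₀.nonneg] with x h1 h2
    rwa [h1]
  zero_on_hole := by
    filter_upwards [hu.initial, hu₀.zero_on_hole] with x h1 h2
    rwa [h1]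
  integrable_mul_logWeight := by
    refine (hu₀.log_integrable.const_mul 2).mono ((L1.integrable_coeFn (u 0)).1.mul
      continuous_logWeight.aestronglyMeasurable) ?_
    filter_upwards [hu.initial, hu₀.zero_on_hole] with x h1 h2
    rw [h1]
    by_cases hx : x ∈ H
    · simp [h2 hx]
    · have hx2 := hH.two_le_norm hx
      have h3 := logWeight_le_two_mul_log hx2
      have h4 := (Real.log_pos one_lt_two).le.trans (log_two_le_logWeight x)
      calc ‖u₀ x * logWeight x‖ = |u₀ x| * logWeight x := by
            rw [norm_mul, Real.norm_of_nonneg h4, Real.norm_eq_abs]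
        _ ≤ |u₀ x| * (2 * Real.log ‖x‖) := by gcongr
        _ ≤ ‖2 * (u₀ x * Real.log ‖x‖)‖ := by
            rw [norm_mul, norm_mul, Real.norm_two, Real.norm_eq_abs,
              Real.norm_of_nonneg (Real.log_nonneg (by linarith : (1 : ℝ) ≤ ‖x‖))]
            exact le_of_eq (by ring)

/-- Termwise integration of an `L¹` series against a weight. -/
theorem integrable_and_integral_tsum_mul {v : ℕ → L1Plane} (hv : Summable fun n => ‖v n‖)
    {g : Plane → ℝ} (hg : AEStronglyMeasurable g volume)
    (hi : ∀ n, Integrable fun x => v n x * g x) (hs : Summable fun n => ∫ x, ‖v n x * g x‖) :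
    Integrable (fun x => (∑' n, v n : L1Plane) x * g x) ∧
      ∫ x, (∑' n, v n : L1Plane) x * g x = ∑' n, ∫ x, v n x * g x := by
  have hv' : ∑' n, ‖v n‖ₑ ≠ ⊤ := tsum_enorm_ne_top_iff_summable_norm.2 hv
  have hcoe : (fun x => (∑' n, v n : L1Plane) x * g x) =ᵐ[volume]
      fun x => ∑' n, v n x * g x := by
    filter_upwards [Lp.coeFn_tsum hv'] with x hx
    rw [hx, tsum_mul_right]
  refine ⟨⟨(L1.integrable_coeFn _).1.mul hg, ?_⟩, ?_⟩
  · refine HasFiniteIntegral.congr ?_ hcoe.symm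
    have h1 : ∫⁻ x, ∑' n, ‖v n x * g x‖ₑ = ∑' n, ‖∫ x, ‖v n x * g x‖‖ₑ := by
      rw [lintegral_tsum fun n => (hi n).1.enorm]
      congr 1; ext n
      rw [← ofReal_integral_norm_eq_lintegral_enorm (hi n), Real.enorm_of_nonneg
        (integral_nonneg fun _ => norm_nonneg _)]
    refine (lintegral_mono fun x => enorm_tsum_le_tsum_enorm).trans_lt (h1.trans_lt ?_)
    exact (tsum_enorm_ne_top_iff_summable_norm.2 hs.norm).lt_top
  · rw [integral_congr_ae hcoe]
    exact (hasSum_integral_of_summable_integral_norm hi hs).tsum_eq.symm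

theorem mainTheorem8 (H : Set Plane) (hH : IsHole H)
    (J : Plane → ℝ) (d : ℝ) (hJ : IsKernel J d)
    (u₀ : Plane → ℝ) (hu₀ : IsInitialDatum H u₀)
    (φ : Plane → ℝ) (hφ : IsLogStationary J H φ)
    (u : ℝ → L1Plane) (hu : IsSolution J H u₀ u) :
    (∀ t : ℝ, 0 ≤ t → Integrable (fun x : Plane => u t x * Real.log ‖x‖) volume) ∧
    Integrable (fun x : Plane => u₀ x * φ x) volume ∧
    Tendsto (fun t : ℝ => ∫ x : Plane, u t x * Real.log ‖x‖) atTop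
      (𝓝 (∫ x : Plane, u₀ x * φ x)) := by
  have hm := hH.isOpen.measurableSet
  have hf := hu.isLogDensity_initial hu₀ hH
  set a : ℕ → L1Plane := fun n => (hJ.killedAvg hm ^ n) (u 0)
  have ha : ∀ n, IsLogDensity H (a n) := hf.killedAvg_pow hJ hm
  have hφ0 : (fun x => u 0 x * φ x) =ᵐ[volume] fun x => u₀ x * φ x :=
    hu.initial.mono fun x hx => by simp only [hx]
  have hlim : Tendsto (fun n => ∫ x : Plane, a n x * Real.log ‖x‖) atTop
      (𝓝 (∫ x, u₀ x * φ x)) := by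
    rw [← integral_congr_ae hφ0]
    exact hf.tendsto_integral_killedAvg_pow_mul_log hJ hH hφ
  obtain ⟨M, hM⟩ := hlim.abs.bddAbove_range
  have hM : ∀ n, |∫ x : Plane, a n x * Real.log ‖x‖| ≤ M := fun n => hM ⟨n, rfl⟩
  have hlog : Measurable fun x : Plane => Real.log ‖x‖ := by fun_prop
  have key : ∀ t : ℝ, 0 ≤ t → Integrable (fun x : Plane => u t x * Real.log ‖x‖) ∧
      ∫ x : Plane, u t x * Real.log ‖x‖ = ∑' n : ℕ, Real.exp (-t) * t ^ n / n.factorial *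
        ∫ x : Plane, a n x * Real.log ‖x‖ := by
    intro t ht
    obtain ⟨hut, hs⟩ := hu.eq_exp hJ hm ht
    have hp : ∀ n : ℕ, 0 ≤ Real.exp (-t) * t ^ n / n.factorial := fun n => by positivity
    have hc : ∀ n : ℕ, (fun x : Plane => ((Real.exp (-t) * t ^ n / n.factorial) • a n : L1Plane) x *
        Real.log ‖x‖) =ᵐ[volume] fun x => Real.exp (-t) * t ^ n / n.factorial *
          (a n x * Real.log ‖x‖) := fun n => by
      filter_upwards [Lp.coeFn_smul (Real.exp (-t) * t ^ n / n.factorial) (a n)] with x hx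
      rw [hx, Pi.smul_apply, smul_eq_mul, mul_assoc]
    have h := integrable_and_integral_tsum_mul hs hlog.aestronglyMeasurable
      -- Each aₙ log|x| is nonnegative almost everywhere, so the integrals of the norms are Poisson
      -- weights times a bounded sequence.
      (fun n => (((ha n).integrable_mul_log hH).const_mul _).congr (hc n).symm) (by
        refine (summable_poisson_mul hM ht).congr fun n => ?_
        rw [← integral_const_mul]
        refine integral_congr_ae ?_
        filter_upwards [hc n, (ha n).mul_log_nonneg hH] with x hx h0
        exact ((congrArg norm hx).trans (Real.norm_of_nonneg (mul_nonneg (hp n) h0))).symm)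
    rw [← hut] at h
    refine ⟨h.1, h.2.trans (tsum_congr fun n => ?_)⟩
    rw [integral_congr_ae (hc n), integral_const_mul]
  refine ⟨fun t ht => (key t ht).1, (hf.integrable_mul_logStationary hH hφ).congr hφ0, ?_⟩
  refine (tendsto_tsum_poisson_mul hlim).congr' ?_
  filter_upwards [eventually_ge_atTop 0] with t ht using (key t ht).2.symm
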